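/- Let $0<\tau<1$ and put $f(\tau)=\tau(1-\tau)/10>0$. For $c>0$, $d\in\mathbb N$ and unit vectors $\psi_0,\psi_1\in\mathbb C^d$ with $|\langle\psi_0|\psi_1\rangle|=\tau$, consider the following state-comparison game. A pair $(x,y)\in\{0,1\}^2$ is drawn uniformly at random and Bob receives the product state $\psi_x\otimes\psi_y\in\mathbb C^d\otimes\mathbb C^d$. He performs a measurement (POVM) $(E_{=},E_{\neq},E_{?})$ on $\mathbb C^d\otimes\mathbb C^d$, whose outcome is his answer "the two states are equal", "the two states are different" or "don't know". His payoff is $1$ if the answer is correct, $0$ if it is "don't know", and $-c$ if it is wrong. Let $p_{\max}$ be the supremum of Bob's expected payoff over all POVMs, $p_s$ its supremum over separable POVMs (those each of whose elements is a finite sum $\sum_i F_i\otimes G_i$ with $F_i,G_i$ positive semidefinite operators on $\mathbb C^d$), and $p_{\mathrm{LOCC}}$ its supremum over the POVMs that can be implemented on the two registers by finitely many rounds of local quantum operations and classical communication. Then for every $0<\tau<1$ there is a $c>0$, depending only on $\tau$, such that for all $d$ and all unit vectors $\psi_0,\psi_1\in\mathbb C^d$ with $|\langle\psi_0|\psi_1\rangle|=\tau$,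 $$p_s\le p_{\max}-f(\tau),\qquad p_{\mathrm{LOCC}}\le p_{\max}-f(\tau);$$ moreover $p_s\le (1-\tau)-f(\tau)$ and $1-\tau\le p_{\max}$. -/

import Mathlib

open scoped Kronecker ComplexOrder Matrix

noncomputable section

namespace StateComparison

/-- Operators on the bipartite system `ℂ^m ⊗ ℂ^n`, in the product basis. -/
abbrev BiOp (m n : ℕ) : Type := Matrix (Fin m × Fin n) (Fin m × Fin n) ℂ

/-- Bob's answers: "the two states are equal", "they are different", "don't know". -/
inductive Answer
  | same
  | different
  | dontKnow
  deriving DecidableEq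

instance : Fintype Answer where
  elems := {.same, .different, .dontKnow}
  complete := by intro a; cases a <;> decide

/-- A measurement (POVM) on `ℂ^m ⊗ ℂ^n` whose outcomes are Bob's answers. -/
structure IsMeasurement {m n : ℕ} (M : Answer → BiOp m n) : Prop where
  posSemidef : ∀ a, (M a).PosSemidef
  sum_eq_one : ∑ a, M a = 1

/-- A separable operator: a finite sum of tensor products of positive semidefinite operators. -/
def IsSeparableOp {m n : ℕ} (E : BiOp m n) : Prop :=
  ∃ (k : ℕ) (F : Fin k → Matrix (Fin m) (Fin m) ℂ) (G : Fin k → Matrix (Fin n) (Fin n) ℂ),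
    (∀ i, (F i).PosSemidef) ∧ (∀ i, (G i).PosSemidef) ∧ E = ∑ i, F i ⊗ₖ G i

/-- A separable measurement: each of its elements is a separable operator. -/
def IsSeparableMeasurement {m n : ℕ} (M : Answer → BiOp m n) : Prop :=
  IsMeasurement M ∧ ∀ a, IsSeparableOp (M a)

/-- The measurements implemented by local operations and classical communication (finitely many
rounds): either an answer is announced, or one of the two sides applies a local
quantum instrument with Kraus operators `K i` (possibly changing the dimension of its system),
communicates the outcome `i`, and an LOCC measurement depending on `i` follows. -/
inductive IsLOCC : ∀ {m n : ℕ}, (Answer → BiOp m n) → Prop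
  | announce {m n : ℕ} (b : Answer) :
      IsLOCC (fun a => if a = b then (1 : BiOp m n) else 0)
  | left {m m' n k : ℕ} (K : Fin k → Matrix (Fin m') (Fin m) ℂ)
      (hK : ∑ i, (K i)ᴴ * K i = 1) (N : Fin k → Answer → BiOp m' n)
      (hN : ∀ i, IsLOCC (N i)) :
      IsLOCC (fun a => ∑ i, (K i ⊗ₖ (1 : Matrix (Fin n) (Fin n) ℂ))ᴴ * N i a *
        (K i ⊗ₖ (1 : Matrix (Fin n) (Fin n) ℂ)))
  | right {m n n' k : ℕ} (K : Fin k → Matrix (Fin n') (Fin n) ℂ)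
      (hK : ∑ i, (K i)ᴴ * K i = 1) (N : Fin k → Answer → BiOp m n')
      (hN : ∀ i, IsLOCC (N i)) :
      IsLOCC (fun a => ∑ i, ((1 : Matrix (Fin m) (Fin m) ℂ) ⊗ₖ K i)ᴴ * N i a *
        ((1 : Matrix (Fin m) (Fin m) ℂ) ⊗ₖ K i))

/-- The product vector `φ ⊗ χ` in the product basis. -/
def tensorVec {m n : ℕ} (φ : EuclideanSpace ℂ (Fin m)) (χ : EuclideanSpace ℂ (Fin n)) :
    Fin m × Fin n → ℂ :=
  fun p => φ p.1 * χ p.2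

/-- Born's rule: the probability `⟨v| E |v⟩` of the outcome with element `E` in the state `v`. -/
def bornProb {m n : ℕ} (E : BiOp m n) (v : Fin m × Fin n → ℂ) : ℝ :=
  (star v ⬝ᵥ (E *ᵥ v)).re

/-- The payoff for the answer `a` if the two registers hold the states number `x` and `y`:
`1` if it is correct, `0` for "don't know", `-c` if it is wrong. -/
def payoff (c : ℝ) (x y : Fin 2) : Answer → ℝ
  | .same => if x = y then 1 else -c
  | .different => if x = y then -c else 1
  | .dontKnow => 0

/-- The expected payoff of the measurement `M` if the pair of states is uniform among the four
products `ψ x ⊗ ψ y`, `x, y ∈ {0, 1}`. -/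
def expectedPayoff {d : ℕ} (c : ℝ) (ψ : Fin 2 → EuclideanSpace ℂ (Fin d))
    (M : Answer → BiOp d d) : ℝ :=
  ∑ x, ∑ y, (1 / 4 : ℝ) * ∑ a, payoff c x y a * bornProb (M a) (tensorVec (ψ x) (ψ y))

/-- The best expected payoff over all measurements. -/
def maxPayoff {d : ℕ} (c : ℝ) (ψ : Fin 2 → EuclideanSpace ℂ (Fin d)) : ℝ :=
  sSup (expectedPayoff c ψ '' {M | IsMeasurement M})

/-- The supremum of the expected payoffs of separable measurements. -/
def sepPayoff {d : ℕ} (c : ℝ) (ψ : Fin 2 → EuclideanSpace ℂ (Fin d)) : ℝ :=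
  sSup (expectedPayoff c ψ '' {M | IsSeparableMeasurement M})

/-- The supremum of the expected payoffs of LOCC measurements. -/
def loccPayoff {d : ℕ} (c : ℝ) (ψ : Fin 2 → EuclideanSpace ℂ (Fin d)) : ℝ :=
  sSup (expectedPayoff c ψ '' {M | IsLOCC M})

/-- The guaranteed gap `f(τ) = τ (1 - τ) / 10`. -/
def gap (τ : ℝ) : ℝ := τ * (1 - τ) / 10

end StateComparison

end

/-! Unambiguous comparison bounds the global optimum below: after a change of phase `ψ 0` and `ψ 1`
are `C a ± S b` with `a`, `b` orthonormal and `2 S² = 1 - τ`, and entangled rank-one elements in the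
span of `a` and `b` give an error-free measurement with success probability `1 - τ`, whatever `c`
is.

On a product element the four amplitudes `α x * β y` satisfy `(α₀β₀)(α₁β₁) = (α₀β₁)(α₁β₀)`, so small
amplitudes for wrong answers force one of the two right ones to be small. Quantitatively
(`norm_sq_add_norm_sq_le_of_mul_eq_mul`), the payoff is at most `|(α₀ - α₁)(β₀ - β₁)|²` up to `O(ε)`
when `c = 1 + 1/ε`. Summed over the answers, this dual witness (`sum_payoff_mul_bornProb_le`) gives
`(1 - τ)² + 4 ε`, strictly below `1 - τ` for small `ε`. LOCC measurements are separable, so they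
obey the same bound. -/

namespace StateComparison

/-! ### Born probabilities on product vectors -/

section BornRule

open scoped MatrixOrder in
theorem exists_eq_conjTranspose_mul_self {l : Type*} [Fintype l] [DecidableEq l]
    {F : Matrix l l ℂ} (hF : F.PosSemidef) : ∃ A : Matrix l l ℂ, F = Aᴴ * A := by
  rw [← Matrix.nonneg_iff_posSemidef, CStarAlgebra.nonneg_iff_eq_star_mul_self] at hF
  exact hF

variable {m n : ℕ}

theorem bornProb_add (E F : BiOp m n) (v : Fin m × Fin n → ℂ) :
    bornProb (E + F) v = bornProb E v + bornProb F v := by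
  simp [bornProb, Matrix.add_mulVec, dotProduct_add]

theorem bornProb_sum {ι : Type*} (s : Finset ι) (E : ι → BiOp m n) (v : Fin m × Fin n → ℂ) :
    bornProb (∑ i ∈ s, E i) v = ∑ i ∈ s, bornProb (E i) v := by
  simp [bornProb, Matrix.sum_mulVec, dotProduct_sum]

theorem bornProb_real_smul (r : ℝ) (E : BiOp m n) (v : Fin m × Fin n → ℂ) :
    bornProb ((r : ℂ) • E) v = r * bornProb E v := by
  simp [bornProb, Matrix.smul_mulVec, dotProduct_smul]

theorem bornProb_smul_vec (E : BiOp m n) (z : ℂ) (v : Fin m × Fin n → ℂ) :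
    bornProb E (z • v) = ‖z‖ ^ 2 * bornProb E v := by
  have h : star z * z = ((‖z‖ ^ 2 : ℝ) : ℂ) := by
    rw [Complex.star_def, ← Complex.normSq_eq_conj_mul_self, Complex.normSq_eq_norm_sq]
  rw [bornProb, Matrix.mulVec_smul, star_smul, smul_dotProduct, dotProduct_smul, smul_smul, h,
    smul_eq_mul, Complex.re_ofReal_mul, bornProb]

theorem bornProb_nonneg {E : BiOp m n} (hE : E.PosSemidef) (v : Fin m × Fin n → ℂ) :
    0 ≤ bornProb E v :=
  (Complex.le_def.1 (hE.dotProduct_mulVec_nonneg v)).1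

theorem star_tensorVec_dotProduct (a c : EuclideanSpace ℂ (Fin m))
    (b e : EuclideanSpace ℂ (Fin n)) :
    star (tensorVec a b) ⬝ᵥ tensorVec c e = inner ℂ a c * inner ℂ b e := by
  simp only [dotProduct, tensorVec, Pi.star_apply, star_mul', PiLp.inner_apply,
    RCLike.inner_apply, Fintype.sum_prod_type, Finset.sum_mul_sum, Complex.star_def]
  refine Finset.sum_congr rfl fun i _ => Finset.sum_congr rfl fun j _ => ?_
  ring

theorem bornProb_one_tensorVec (a : EuclideanSpace ℂ (Fin m)) (b : EuclideanSpace ℂ (Fin n)) :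
    bornProb 1 (tensorVec a b) = ‖a‖ ^ 2 * ‖b‖ ^ 2 := by
  rw [bornProb, Matrix.one_mulVec, star_tensorVec_dotProduct, inner_self_eq_norm_sq_to_K,
    inner_self_eq_norm_sq_to_K]
  norm_cast

theorem bornProb_vecMulVec (w v : Fin m × Fin n → ℂ) :
    bornProb (Matrix.vecMulVec w (star w)) v = ‖star w ⬝ᵥ v‖ ^ 2 := by
  rw [bornProb, Matrix.vecMulVec_mulVec, ← Complex.normSq_eq_norm_sq,
    op_smul_eq_smul, dotProduct_smul, smul_eq_mul]
  have h : star v ⬝ᵥ w = star (star w ⬝ᵥ v) := Matrix.star_dotProduct v w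
  rw [h, Complex.star_def, Complex.mul_conj, Complex.ofReal_re]

theorem bornProb_conjTranspose_mul_self {l : Type*} [Fintype l]
    (K : Matrix l (Fin m × Fin n) ℂ) (v : Fin m × Fin n → ℂ) :
    bornProb (Kᴴ * K) v = ∑ p, ‖(K *ᵥ v) p‖ ^ 2 := by
  rw [bornProb, ← Matrix.mulVec_mulVec, Matrix.dotProduct_mulVec, ← Matrix.star_mulVec]
  simp only [dotProduct, Pi.star_apply, Complex.re_sum, Complex.star_def]
  refine Finset.sum_congr rfl fun p _ => ?_
  rw [← Complex.normSq_eq_conj_mul_self, Complex.ofReal_re, Complex.normSq_eq_norm_sq]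

theorem kronecker_mulVec_tensorVec {m' n' : Type*} (A : Matrix m' (Fin m) ℂ)
    (B : Matrix n' (Fin n) ℂ) (a : EuclideanSpace ℂ (Fin m)) (b : EuclideanSpace ℂ (Fin n))
    (r : m') (s : n') :
    ((A ⊗ₖ B) *ᵥ tensorVec a b) (r, s) = (A *ᵥ a.ofLp) r * (B *ᵥ b.ofLp) s := by
  simp only [Matrix.mulVec, dotProduct, tensorVec, Matrix.kroneckerMap_apply,
    Fintype.sum_prod_type, Finset.sum_mul_sum]
  refine Finset.sum_congr rfl fun i _ => Finset.sum_congr rfl fun j _ => ?_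
  ring

/-- Reduces a product element to a sum of squared product amplitudes, so that inequalities for
separable elements can be checked on complex numbers. -/
theorem bornProb_kronecker_gram (A : Matrix (Fin m) (Fin m) ℂ) (B : Matrix (Fin n) (Fin n) ℂ)
    (a : EuclideanSpace ℂ (Fin m)) (b : EuclideanSpace ℂ (Fin n)) :
    bornProb ((Aᴴ * A) ⊗ₖ (Bᴴ * B)) (tensorVec a b) =
      ∑ p : Fin m × Fin n, ‖(A *ᵥ a.ofLp) p.1 * (B *ᵥ b.ofLp) p.2‖ ^ 2 := by
  rw [Matrix.mul_kronecker_mul, ← Matrix.conjTranspose_kronecker,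
    bornProb_conjTranspose_mul_self]
  exact Finset.sum_congr rfl fun p _ => by rw [← kronecker_mulVec_tensorVec]

end BornRule

/-! ### Separable operators, and LOCC as a special case -/

section Separable

variable {m n : ℕ}

theorem IsSeparableOp.kronecker {F : Matrix (Fin m) (Fin m) ℂ} {G : Matrix (Fin n) (Fin n) ℂ}
    (hF : F.PosSemidef) (hG : G.PosSemidef) : IsSeparableOp (F ⊗ₖ G) :=
  ⟨1, fun _ => F, fun _ => G, fun _ => hF, fun _ => hG, by simp⟩

theorem IsSeparableOp.zero : IsSeparableOp (0 : BiOp m n) :=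
  ⟨0, fun _ => 0, fun _ => 0, fun i => i.elim0, fun i => i.elim0, by simp⟩

theorem IsSeparableOp.one : IsSeparableOp (1 : BiOp m n) := by
  rw [← Matrix.one_kronecker_one]
  exact .kronecker .one .one

theorem IsSeparableOp.add {E E' : BiOp m n} (h : IsSeparableOp E) (h' : IsSeparableOp E') :
    IsSeparableOp (E + E') := by
  obtain ⟨k, F, G, hF, hG, rfl⟩ := h
  obtain ⟨k', F', G', hF', hG', rfl⟩ := h'
  refine ⟨k + k', Fin.append F F', Fin.append G G', fun i => ?_, fun i => ?_, ?_⟩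
  · refine Fin.addCases (fun j => ?_) (fun j => ?_) i <;> simp [hF, hF']
  · refine Fin.addCases (fun j => ?_) (fun j => ?_) i <;> simp [hG, hG']
  · simp [Fin.sum_univ_add]

theorem IsSeparableOp.sum {ι : Type*} (s : Finset ι) {E : ι → BiOp m n}
    (h : ∀ i ∈ s, IsSeparableOp (E i)) : IsSeparableOp (∑ i ∈ s, E i) :=
  Finset.sum_induction E IsSeparableOp (fun _ _ => .add) .zero h

theorem IsSeparableOp.posSemidef {E : BiOp m n} (h : IsSeparableOp E) : E.PosSemidef := by
  obtain ⟨k, F, G, hF, hG, rfl⟩ := h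
  exact Matrix.posSemidef_sum _ fun i _ => (hF i).kronecker (hG i)

theorem IsSeparableOp.conj {m' n' : ℕ} {E : BiOp m' n'} (h : IsSeparableOp E)
    (A : Matrix (Fin m') (Fin m) ℂ) (B : Matrix (Fin n') (Fin n) ℂ) :
    IsSeparableOp ((A ⊗ₖ B)ᴴ * E * (A ⊗ₖ B)) := by
  obtain ⟨k, F, G, hF, hG, rfl⟩ := h
  rw [Matrix.mul_sum, Matrix.sum_mul]
  refine .sum _ fun i _ => ?_
  rw [Matrix.conjTranspose_kronecker, ← Matrix.mul_kronecker_mul, ← Matrix.mul_kronecker_mul]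
  exact .kronecker ((hF i).conjTranspose_mul_mul_same A) ((hG i).conjTranspose_mul_mul_same B)

theorem isSeparableMeasurement_iff {M : Answer → BiOp m n} :
    IsSeparableMeasurement M ↔ (∀ a, IsSeparableOp (M a)) ∧ ∑ a, M a = 1 :=
  ⟨fun h => ⟨h.2, h.1.sum_eq_one⟩, fun h => ⟨⟨fun a => (h.1 a).posSemidef, h.2⟩, h.1⟩⟩

/-- By induction on the protocol: conjugation by the local operators `K i ⊗ 1` or `1 ⊗ K i`
preserves separability, and completeness of the Kraus operators preserves the total. -/
theorem IsLOCC.isSeparableMeasurement {M : Answer → BiOp m n} (h : IsLOCC M) :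
    IsSeparableMeasurement M := by
  induction h with
  | announce b =>
    refine isSeparableMeasurement_iff.2 ⟨fun a => ?_, by simp⟩
    split_ifs
    exacts [.one, .zero]
  | left K hK N hN ih =>
    refine isSeparableMeasurement_iff.2
      ⟨fun a => .sum _ fun i _ => ((ih i).2 a).conj _ _, ?_⟩
    rw [Finset.sum_comm]
    simp_rw [← Matrix.sum_mul, ← Matrix.mul_sum, (ih _).1.sum_eq_one, Matrix.mul_one,
      Matrix.conjTranspose_kronecker, ← Matrix.mul_kronecker_mul, Matrix.conjTranspose_one,
      Matrix.mul_one]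
    rw [← Matrix.one_kronecker_one, ← hK]
    ext p q
    simp [Matrix.sum_apply, Matrix.kroneckerMap_apply, Finset.sum_mul]
  | right K hK N hN ih =>
    refine isSeparableMeasurement_iff.2
      ⟨fun a => .sum _ fun i _ => ((ih i).2 a).conj _ _, ?_⟩
    rw [Finset.sum_comm]
    simp_rw [← Matrix.sum_mul, ← Matrix.mul_sum, (ih _).1.sum_eq_one, Matrix.mul_one,
      Matrix.conjTranspose_kronecker, ← Matrix.mul_kronecker_mul, Matrix.conjTranspose_one,
      Matrix.mul_one]
    rw [← Matrix.one_kronecker_one, ← hK]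
    ext p q
    simp [Matrix.sum_apply, Matrix.kroneckerMap_apply, Finset.mul_sum]

end Separable

/-! ### The upper bound for separable measurements -/

section Payoff

variable {d : ℕ}

theorem sum_answer {β : Type*} [AddCommMonoid β] (f : Answer → β) :
    ∑ a, f a = f .same + f .different + f .dontKnow := by
  change ∑ a ∈ ({.same, .different, .dontKnow} : Finset Answer), f a = _
  simp [add_assoc]

theorem expectedPayoff_le_one {c : ℝ} (hc : 0 < c) {ψ : Fin 2 → EuclideanSpace ℂ (Fin d)}
    (hψ : ∀ x, ‖ψ x‖ = 1) {M : Answer → BiOp d d} (hM : IsMeasurement M) :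
    expectedPayoff c ψ M ≤ 1 := by
  have key : ∀ x y, ∑ a, payoff c x y a * bornProb (M a) (tensorVec (ψ x) (ψ y)) ≤ 1 := by
    intro x y
    calc ∑ a, payoff c x y a * bornProb (M a) (tensorVec (ψ x) (ψ y))
        ≤ ∑ a, bornProb (M a) (tensorVec (ψ x) (ψ y)) := by
          refine Finset.sum_le_sum fun a _ =>
            mul_le_of_le_one_left (bornProb_nonneg (hM.posSemidef a) _) ?_
          cases a <;> simp only [payoff] <;> (try split_ifs) <;> linarith
      _ = 1 := by simp [← bornProb_sum, hM.sum_eq_one, bornProb_one_tensorVec, hψ]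
  simp only [expectedPayoff, Fin.sum_univ_two]
  linarith [key 0 0, key 0 1, key 1 0, key 1 1]

/-- Here `u`, `v` are the amplitudes for a right answer and `w`, `z` those for a wrong one. The
penalty `1 + 1/ε` splits: `1` absorbs the cross term of `‖u + v‖²`, and `1/ε` the cross term between
`u + v` and `w + z`. -/
theorem norm_sq_add_norm_sq_le_of_mul_eq_mul {ε : ℝ} (hε : 0 < ε) {u v w z : ℂ}
    (h : u * v = w * z) :
    ‖u‖ ^ 2 + ‖v‖ ^ 2 - (1 + 1 / ε) * (‖w‖ ^ 2 + ‖z‖ ^ 2) ≤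
      ‖u + v - w - z‖ ^ 2 + 4 * ε * (‖u‖ ^ 2 + ‖v‖ ^ 2) := by
  have par : ∀ a b : ℂ, ‖a + b‖ ^ 2 ≤ 2 * (‖a‖ ^ 2 + ‖b‖ ^ 2) := fun a b => by
    nlinarith [norm_add_le a b, norm_nonneg (a + b), sq_nonneg (‖a‖ - ‖b‖),
      norm_nonneg a, norm_nonneg b]
  have h₁ : ‖u‖ ^ 2 + ‖v‖ ^ 2 ≤ ‖u + v‖ ^ 2 + (‖w‖ ^ 2 + ‖z‖ ^ 2) := by
    have e := norm_add_sq_real u v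
    have i := neg_le_of_abs_le (abs_real_inner_le_norm u v)
    -- The product structure enters only here.
    have j : ‖u‖ * ‖v‖ = ‖w‖ * ‖z‖ := by rw [← norm_mul, h, norm_mul]
    nlinarith [sq_nonneg (‖w‖ - ‖z‖)]
  have h₂ : ‖u + v‖ ^ 2 ≤
      ‖u + v - w - z‖ ^ 2 + 2 * ε * ‖u + v‖ ^ 2 + 1 / (2 * ε) * ‖w + z‖ ^ 2 := by
    have e := norm_sub_sq_real (u + v) (w + z)
    rw [← sub_sub] at e
    have i := le_of_abs_le (abs_real_inner_le_norm (u + v) (w + z))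
    -- Young's inequality with weight `2 ε`, by completing the square.
    have k : 2 * ε * ‖u + v‖ ^ 2 + 1 / (2 * ε) * ‖w + z‖ ^ 2 - 2 * (‖u + v‖ * ‖w + z‖) =
        (2 * ε * ‖u + v‖ - ‖w + z‖) ^ 2 / (2 * ε) := by
      field_simp
      ring
    have k' : 0 ≤ (2 * ε * ‖u + v‖ - ‖w + z‖) ^ 2 / (2 * ε) := by positivity
    nlinarith [sq_nonneg ‖w + z‖]
  have h₃ : 2 * ε * ‖u + v‖ ^ 2 ≤ 2 * ε * (2 * (‖u‖ ^ 2 + ‖v‖ ^ 2)) := by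
    gcongr
    exact par u v
  have h₄ : 1 / (2 * ε) * ‖w + z‖ ^ 2 ≤ 1 / (2 * ε) * (2 * (‖w‖ ^ 2 + ‖z‖ ^ 2)) := by
    gcongr
    exact par w z
  have h₅ : 1 / (2 * ε) * (2 * (‖w‖ ^ 2 + ‖z‖ ^ 2)) = 1 / ε * (‖w‖ ^ 2 + ‖z‖ ^ 2) := by
    field_simp
  linarith

/-- The dual witness for separable measurements: on a separable element `E`, the payoff operator
of every answer is dominated by `|δ ⊗ δ⟩⟨δ ⊗ δ| + 4 ε ∑ |ψ x ⊗ ψ y⟩⟨ψ x ⊗ ψ y|`, where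
`δ = ψ 0 - ψ 1`. -/
theorem sum_payoff_mul_bornProb_le {ε : ℝ} (hε : 0 < ε) (ψ : Fin 2 → EuclideanSpace ℂ (Fin d))
    (a : Answer) {E : BiOp d d} (hE : IsSeparableOp E) :
    ∑ x, ∑ y, payoff (1 + 1 / ε) x y a * bornProb E (tensorVec (ψ x) (ψ y)) ≤
      bornProb E (tensorVec (ψ 0 - ψ 1) (ψ 0 - ψ 1)) +
        4 * ε * ∑ x, ∑ y, bornProb E (tensorVec (ψ x) (ψ y)) := by
  obtain ⟨k, F, G, hF, hG, rfl⟩ := hE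
  have key : ∀ i, ∑ x, ∑ y, payoff (1 + 1 / ε) x y a *
        bornProb (F i ⊗ₖ G i) (tensorVec (ψ x) (ψ y)) ≤
      bornProb (F i ⊗ₖ G i) (tensorVec (ψ 0 - ψ 1) (ψ 0 - ψ 1)) +
        4 * ε * ∑ x, ∑ y, bornProb (F i ⊗ₖ G i) (tensorVec (ψ x) (ψ y)) := by
    intro i
    obtain ⟨A, hA⟩ := exists_eq_conjTranspose_mul_self (hF i)
    obtain ⟨B, hB⟩ := exists_eq_conjTranspose_mul_self (hG i)
    rw [hA, hB]
    simp only [bornProb_kronecker_gram, Fin.sum_univ_two, Finset.mul_sum,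
      ← Finset.sum_add_distrib]
    refine Finset.sum_le_sum fun p _ => ?_
    simp only [WithLp.ofLp_sub, Matrix.mulVec_sub, Pi.sub_apply]
    generalize (A *ᵥ (ψ 0).ofLp) p.1 = α₀
    generalize (A *ᵥ (ψ 1).ofLp) p.1 = α₁
    generalize (B *ᵥ (ψ 0).ofLp) p.2 = β₀
    generalize (B *ᵥ (ψ 1).ofLp) p.2 = β₁
    have e₁ : (α₀ - α₁) * (β₀ - β₁) = α₀ * β₀ + α₁ * β₁ - α₀ * β₁ - α₁ * β₀ := by ring
    have e₂ : ‖(α₀ - α₁) * (β₀ - β₁)‖ = ‖α₀ * β₁ + α₁ * β₀ - α₀ * β₀ - α₁ * β₁‖ := by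
      rw [← norm_neg]; congr 1; ring
    -- The scalar inequality charges `4 ε` only to the right amplitudes; the witness charges it to
    -- all four, so that it is the same for every answer.
    have hp : ∀ s t : ℂ, 0 ≤ 4 * ε * (‖s‖ ^ 2 + ‖t‖ ^ 2) := fun s t => by positivity
    cases a with
    | same =>
      have := norm_sq_add_norm_sq_le_of_mul_eq_mul hε
        (show (α₀ * β₀) * (α₁ * β₁) = (α₀ * β₁) * (α₁ * β₀) by ring)
      rw [e₁]
      simp only [payoff, if_true, Fin.isValue, zero_ne_one, one_ne_zero, if_false]
      linarith [hp (α₀ * β₁) (α₁ * β₀)]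
    | different =>
      have := norm_sq_add_norm_sq_le_of_mul_eq_mul hε
        (show (α₀ * β₁) * (α₁ * β₀) = (α₀ * β₀) * (α₁ * β₁) by ring)
      rw [e₂]
      simp only [payoff, if_true, Fin.isValue, zero_ne_one, one_ne_zero, if_false]
      linarith [hp (α₀ * β₀) (α₁ * β₁)]
    | dontKnow =>
      simp only [payoff, zero_mul, add_zero]
      positivity
  simp only [bornProb_sum, Fin.sum_univ_two, Finset.mul_sum, ← Finset.sum_add_distrib] at key ⊢
  exact Finset.sum_le_sum fun i _ => key i

/-- The witness does not depend on the answer, so summing over the answers replaces `E` by the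
identity: the prior `1/4` turns `‖δ‖⁴` into `(‖δ‖²/2)²`, and the four unit vectors contribute `4 ε`.
-/
theorem expectedPayoff_le_of_isSeparableMeasurement {ε : ℝ} (hε : 0 < ε)
    {ψ : Fin 2 → EuclideanSpace ℂ (Fin d)} (hψ : ∀ x, ‖ψ x‖ = 1) {M : Answer → BiOp d d}
    (hM : IsSeparableMeasurement M) :
    expectedPayoff (1 + 1 / ε) ψ M ≤ (‖ψ 0 - ψ 1‖ ^ 2 / 2) ^ 2 + 4 * ε := by
  have h := Finset.sum_le_sum fun a (_ : a ∈ Finset.univ) =>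
    sum_payoff_mul_bornProb_le hε ψ a (hM.2 a)
  have one : ∀ v : Fin d × Fin d → ℂ, ∑ a, bornProb (M a) v = bornProb 1 v := fun v => by
    rw [← bornProb_sum, hM.1.sum_eq_one]
  have h₀ := one (tensorVec (ψ 0 - ψ 1) (ψ 0 - ψ 1))
  have h₁ := fun x y => one (tensorVec (ψ x) (ψ y))
  simp only [bornProb_one_tensorVec, hψ] at h₀ h₁
  have h₀₀ := h₁ 0 0
  have h₀₁ := h₁ 0 1
  have h₁₀ := h₁ 1 0
  have h₁₁ := h₁ 1 1
  simp only [sum_answer, Fin.sum_univ_two] at h h₀ h₀₀ h₀₁ h₁₀ h₁₁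
  simp only [expectedPayoff, sum_answer, Fin.sum_univ_two]
  nlinarith

theorem expectedPayoff_phase (c : ℝ) (ψ : Fin 2 → EuclideanSpace ℂ (Fin d)) {ω : Fin 2 → ℂ}
    (hω : ∀ x, ‖ω x‖ = 1) (M : Answer → BiOp d d) :
    expectedPayoff c (fun x => ω x • ψ x) M = expectedPayoff c ψ M := by
  have h : ∀ x y, tensorVec (ω x • ψ x) (ω y • ψ y) =
      (ω x * ω y) • tensorVec (ψ x) (ψ y) := fun x y => by
    ext p
    simp [tensorVec]
    ring
  simp [expectedPayoff, h, bornProb_smul_vec, hω]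

end Payoff

/-! ### The error-free entangled measurement -/

section UnambiguousComparison

variable {d : ℕ}

/-- The measurement that compares `C a + S b` and `C a - S b` without error, for orthonormal `a`
and `b` and `κ = S² / C²`. -/
noncomputable def unambiguousMeasurement (a b : EuclideanSpace ℂ (Fin d)) (κ : ℝ) : Answer → BiOp d d :=
  let rankOne : (Fin d × Fin d → ℂ) → BiOp d d := fun v => Matrix.vecMulVec v (star v)
  let E₁ := ((1 / 2 : ℝ) : ℂ) • (rankOne (tensorVec a b + tensorVec b a) +
    rankOne ((κ : ℂ) • tensorVec a a + tensorVec b b))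
  let E₂ := ((1 / 2 : ℝ) : ℂ) • (rankOne (tensorVec a b - tensorVec b a) +
    rankOne ((κ : ℂ) • tensorVec a a - tensorVec b b))
  fun
  | .same => E₁
  | .different => E₂
  | .dontKnow => 1 - E₁ - E₂

theorem isMeasurement_unambiguousMeasurement {a b : EuclideanSpace ℂ (Fin d)} {κ : ℝ}
    (ha : ‖a‖ = 1) (hb : ‖b‖ = 1) (hab : inner ℂ a b = 0) (hκ₀ : 0 ≤ κ) (hκ₁ : κ ≤ 1) :
    IsMeasurement (unambiguousMeasurement a b κ) := by
  have half : (0 : ℂ) ≤ ((1 / 2 : ℝ) : ℂ) := by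
    rw [Complex.zero_le_real]; norm_num
  refine ⟨fun x => ?_, ?_⟩
  · cases x with
    | same =>
      exact ((Matrix.posSemidef_vecMulVec_self_star _).add
        (Matrix.posSemidef_vecMulVec_self_star _)).smul half
    | different =>
      exact ((Matrix.posSemidef_vecMulVec_self_star _).add
        (Matrix.posSemidef_vecMulVec_self_star _)).smul half
    | dontKnow =>
      set P := Matrix.vecMulVec a.ofLp (star a.ofLp) with hP
      set R := Matrix.vecMulVec b.ofLp (star b.ofLp) with hR
      have aa : star a.ofLp ⬝ᵥ a.ofLp = 1 := by
        rw [dotProduct_comm, ← EuclideanSpace.inner_eq_star_dotProduct,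
          inner_self_eq_norm_sq_to_K, ha]; simp
      have bb : star b.ofLp ⬝ᵥ b.ofLp = 1 := by
        rw [dotProduct_comm, ← EuclideanSpace.inner_eq_star_dotProduct,
          inner_self_eq_norm_sq_to_K, hb]; simp
      have ab : star a.ofLp ⬝ᵥ b.ofLp = 0 := by
        rw [dotProduct_comm, ← EuclideanSpace.inner_eq_star_dotProduct, hab]
      have ba : star b.ofLp ⬝ᵥ a.ofLp = 0 := by
        rw [dotProduct_comm, ← EuclideanSpace.inner_eq_star_dotProduct,
          inner_eq_zero_symm.1 hab]
      have hPP : P.PosSemidef := Matrix.posSemidef_vecMulVec_self_star _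
      have hRR : R.PosSemidef := Matrix.posSemidef_vecMulVec_self_star _
      have idem : (P + R) * (P + R) = P + R := by
        simp [hP, hR, Matrix.add_mul, Matrix.mul_add, Matrix.vecMulVec_mul_vecMulVec,
          aa, bb, ab, ba]
      have herm : (P + R)ᴴ = P + R := (hPP.add hRR).isHermitian
      have hQ : (1 - (P + R)).PosSemidef := by
        have := Matrix.posSemidef_conjTranspose_mul_self (1 - (P + R))
        rwa [Matrix.conjTranspose_sub, herm, Matrix.conjTranspose_one, Matrix.sub_mul,
          Matrix.mul_sub, Matrix.mul_sub, idem, Matrix.mul_one, Matrix.mul_one, sub_self,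
          sub_zero, Matrix.one_mul] at this
      have hκ : (0 : ℂ) ≤ ((1 - κ ^ 2 : ℝ) : ℂ) := by
        rw [Complex.zero_le_real]; nlinarith
      -- In `E₁ + E₂` the cross terms cancel, leaving the projector onto span{a, b}⊗span{a, b} with
      -- weight `κ²` instead of `1` on `a ⊗ a`.
      have decomp : unambiguousMeasurement a b κ .dontKnow =
          (1 - (P + R)) ⊗ₖ 1 + (P + R) ⊗ₖ (1 - (P + R)) +
            ((1 - κ ^ 2 : ℝ) : ℂ) • (P ⊗ₖ P) := by
        dsimp only [unambiguousMeasurement]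
        ext ⟨i, j⟩ ⟨k, l⟩
        have one_entry : (1 : BiOp d d) (i, j) (k, l) =
            (1 : Matrix (Fin d) (Fin d) ℂ) i k * (1 : Matrix (Fin d) (Fin d) ℂ) j l := by
          rw [← Matrix.one_kronecker_one, Matrix.kroneckerMap_apply]
        simp [hP, hR, Matrix.vecMulVec_apply, tensorVec]
        linear_combination one_entry
      rw [decomp]
      exact ((hQ.kronecker .one).add ((hPP.add hRR).kronecker hQ)).add
        ((hPP.kronecker hPP).smul hκ)
  · rw [sum_answer]
    simp only [unambiguousMeasurement]
    abel

theorem expectedPayoff_unambiguousMeasurement (c : ℝ) {a b : EuclideanSpace ℂ (Fin d)} {C S : ℝ}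
    (hC : C ≠ 0) (hCS : C ^ 2 + S ^ 2 = 1) (ha : ‖a‖ = 1) (hb : ‖b‖ = 1)
    (hab : inner ℂ a b = 0) {ψ : Fin 2 → EuclideanSpace ℂ (Fin d)}
    (h0 : ψ 0 = (C : ℂ) • a + (S : ℂ) • b) (h1 : ψ 1 = (C : ℂ) • a - (S : ℂ) • b) :
    expectedPayoff c ψ (unambiguousMeasurement a b (S ^ 2 / C ^ 2)) = 2 * S ^ 2 := by
  have ba : inner ℂ b a = 0 := inner_eq_zero_symm.1 hab
  have h2 : 2 * C ^ 2 * S ^ 2 + 2 * S ^ 4 = 2 * S ^ 2 := by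
    linear_combination 2 * S ^ 2 * hCS
  have expand : ∀ (κ : ℝ) (x y : EuclideanSpace ℂ (Fin d)) (p q r s : ℝ),
      inner ℂ a x = p → inner ℂ b x = q → inner ℂ a y = r → inner ℂ b y = s →
      bornProb (unambiguousMeasurement a b κ .same) (tensorVec x y) =
          1 / 2 * ((p * s + q * r) ^ 2 + (κ * (p * r) + q * s) ^ 2) ∧
        bornProb (unambiguousMeasurement a b κ .different) (tensorVec x y) =
          1 / 2 * ((p * s - q * r) ^ 2 + (κ * (p * r) - q * s) ^ 2) := by
    intro κ x y p q r s hp hq hr hs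
    constructor <;>
    · simp only [unambiguousMeasurement]
      rw [bornProb_real_smul, bornProb_add, bornProb_vecMulVec, bornProb_vecMulVec]
      simp only [star_add, star_sub, star_smul, add_dotProduct, sub_dotProduct, smul_dotProduct,
        star_tensorVec_dotProduct, hp, hq, hr, hs, smul_eq_mul, Complex.star_def,
        Complex.conj_ofReal]
      norm_cast
      simp only [Real.norm_eq_abs, sq_abs]
  have a0 : inner ℂ a (ψ 0) = C := by simp [h0, ha, hab]
  have b0 : inner ℂ b (ψ 0) = S := by simp [h0, hb, ba]
  have a1 : inner ℂ a (ψ 1) = C := by simp [h1, ha, hab]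
  have b1 : inner ℂ b (ψ 1) = ((-S : ℝ) : ℂ) := by simp [h1, hb, ba]
  -- This choice of `κ` makes every amplitude for a wrong answer vanish, hence the independence of
  -- `c`.
  have cancel : S ^ 2 / C ^ 2 * (C * C) = S ^ 2 := by field_simp
  have e00 := expand (S ^ 2 / C ^ 2) _ _ _ _ _ _ a0 b0 a0 b0
  have e01 := expand (S ^ 2 / C ^ 2) _ _ _ _ _ _ a0 b0 a1 b1
  have e10 := expand (S ^ 2 / C ^ 2) _ _ _ _ _ _ a1 b1 a0 b0
  have e11 := expand (S ^ 2 / C ^ 2) _ _ _ _ _ _ a1 b1 a1 b1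
  simp only [expectedPayoff, sum_answer, Fin.sum_univ_two, e00, e01, e10, e11, payoff, cancel,
    if_true, Fin.isValue, zero_ne_one, one_ne_zero, if_false]
  linear_combination h2

theorem exists_isMeasurement_expectedPayoff_eq (c : ℝ) {τ : ℝ} (hτ₀ : 0 < τ) (hτ₁ : τ < 1)
    {ψ : Fin 2 → EuclideanSpace ℂ (Fin d)} (hψ : ∀ x, ‖ψ x‖ = 1)
    (hin : inner ℂ (ψ 0) (ψ 1) = (τ : ℂ)) :
    ∃ M : Answer → BiOp d d, IsMeasurement M ∧ expectedPayoff c ψ M = 1 - τ := by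
  have hin' : inner ℂ (ψ 1) (ψ 0) = (τ : ℂ) := by
    rw [← inner_conj_symm, hin, Complex.conj_ofReal]
  have self : ∀ x, inner ℂ (ψ x) (ψ x) = (1 : ℂ) := fun x => by
    rw [inner_self_eq_norm_sq_to_K, hψ]; simp
  -- `C` and `S` are half the norms of `ψ 0 + ψ 1` and `ψ 0 - ψ 1`.
  obtain ⟨C, hC, hC2⟩ : ∃ C : ℝ, 0 < C ∧ C ^ 2 = (1 + τ) / 2 :=
    ⟨√((1 + τ) / 2), by positivity, Real.sq_sqrt (by linarith)⟩
  obtain ⟨S, hS, hS2⟩ : ∃ S : ℝ, 0 < S ∧ S ^ 2 = (1 - τ) / 2 :=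
    ⟨√((1 - τ) / 2), Real.sqrt_pos.2 (by linarith), Real.sq_sqrt (by linarith)⟩
  have hC' : (C : ℂ) ≠ 0 := by exact_mod_cast hC.ne'
  have hS' : (S : ℂ) ≠ 0 := by exact_mod_cast hS.ne'
  have norm_one : ∀ v : EuclideanSpace ℂ (Fin d), inner ℂ v v = (1 : ℂ) → ‖v‖ = 1 := by
    intro v hv
    have h := inner_self_eq_norm_sq (𝕜 := ℂ) v
    rw [hv, RCLike.one_re] at h
    exact (pow_eq_one_iff_of_nonneg (norm_nonneg v) two_ne_zero).1 h.symm
  set a : EuclideanSpace ℂ (Fin d) := ((1 / (2 * C) : ℝ) : ℂ) • (ψ 0 + ψ 1) with hadef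
  set b : EuclideanSpace ℂ (Fin d) := ((1 / (2 * S) : ℝ) : ℂ) • (ψ 0 - ψ 1) with hbdef
  have hCc : (C : ℂ) ^ 2 = (1 + τ) / 2 := by exact_mod_cast hC2
  have hSc : (S : ℂ) ^ 2 = (1 - τ) / 2 := by exact_mod_cast hS2
  have ha : ‖a‖ = 1 := norm_one _ <| by
    simp only [hadef, inner_smul_left, inner_smul_right, inner_add_left, inner_add_right, self,
      hin, hin', Complex.conj_ofReal]
    push_cast
    field_simp
    linear_combination (-4) * hCc
  have hb : ‖b‖ = 1 := norm_one _ <| by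
    simp only [hbdef, inner_smul_left, inner_smul_right, inner_sub_left, inner_sub_right, self,
      hin, hin', Complex.conj_ofReal]
    push_cast
    field_simp
    linear_combination (-4) * hSc
  have hab : inner ℂ a b = 0 := by
    simp only [hadef, hbdef, inner_smul_left, inner_smul_right, inner_add_left, inner_sub_right,
      self, hin, hin']
    ring
  have eC : (C : ℂ) • a = (1 / 2 : ℂ) • (ψ 0 + ψ 1) := by
    rw [hadef, smul_smul]; congr 1; push_cast; field_simp
  have eS : (S : ℂ) • b = (1 / 2 : ℂ) • (ψ 0 - ψ 1) := by
    rw [hbdef, smul_smul]; congr 1; push_cast; field_simp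
  refine ⟨_, isMeasurement_unambiguousMeasurement ha hb hab (κ := S ^ 2 / C ^ 2)
    (by positivity) ?_, ?_⟩
  · rw [div_le_one (by positivity)]
    linarith
  · rw [expectedPayoff_unambiguousMeasurement c hC.ne' (by linarith) ha hb hab]
    · linarith
    · rw [eC, eS]; module
    · rw [eC, eS]; module

end UnambiguousComparison

/-! ### Passing to suprema, and fixing the phase -/

section Suprema

variable {d : ℕ}

theorem bddAbove_expectedPayoff {c : ℝ} (hc : 0 < c) {ψ : Fin 2 → EuclideanSpace ℂ (Fin d)}
    (hψ : ∀ x, ‖ψ x‖ = 1) : BddAbove (expectedPayoff c ψ '' {M | IsMeasurement M}) := by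
  refine ⟨1, ?_⟩
  rintro _ ⟨M, hM, rfl⟩
  exact expectedPayoff_le_one hc hψ hM

theorem loccPayoff_le_sepPayoff {c : ℝ} (hc : 0 < c) {ψ : Fin 2 → EuclideanSpace ℂ (Fin d)}
    (hψ : ∀ x, ‖ψ x‖ = 1) : loccPayoff c ψ ≤ sepPayoff c ψ :=
  csSup_le_csSup ((bddAbove_expectedPayoff hc hψ).mono (Set.image_mono fun _ h => h.1))
    (Set.Nonempty.image _ ⟨_, IsLOCC.announce .dontKnow⟩)
    (Set.image_mono fun _ h => h.isSeparableMeasurement)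

/-- The phase of `ψ 1` is irrelevant, so that the inner product may be taken real. -/
theorem exists_phase {τ : ℝ} (hτ₀ : 0 < τ) {ψ : Fin 2 → EuclideanSpace ℂ (Fin d)}
    (hin : ‖inner ℂ (ψ 0) (ψ 1)‖ = τ) :
    ∃ ω : Fin 2 → ℂ, (∀ x, ‖ω x‖ = 1) ∧ inner ℂ (ω 0 • ψ 0) (ω 1 • ψ 1) = (τ : ℂ) := by
  set z : ℂ := inner ℂ (ψ 0) (ψ 1) with hz
  have hτ : (τ : ℂ) ≠ 0 := by exact_mod_cast hτ₀.ne'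
  refine ⟨![1, star z / τ], fun x => ?_, ?_⟩
  · fin_cases x
    · simp
    · simp [hin, abs_of_pos hτ₀, hτ₀.ne']
  · have : star z * z = (τ : ℂ) ^ 2 := by
      rw [Complex.star_def, ← Complex.normSq_eq_conj_mul_self, Complex.normSq_eq_norm_sq, hin]
      norm_cast
    simp only [Matrix.cons_val_zero, Matrix.cons_val_one, one_smul, inner_smul_right, ← hz]
    rw [div_mul_eq_mul_div, this]
    field_simp

theorem sepPayoff_le_and_le_maxPayoff {τ ε : ℝ} (hτ₀ : 0 < τ) (hτ₁ : τ < 1) (hε : 0 < ε)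
    {ψ : Fin 2 → EuclideanSpace ℂ (Fin d)} (hψ : ∀ x, ‖ψ x‖ = 1)
    (hin : ‖inner ℂ (ψ 0) (ψ 1)‖ = τ) :
    sepPayoff (1 + 1 / ε) ψ ≤ (1 - τ) ^ 2 + 4 * ε ∧ 1 - τ ≤ maxPayoff (1 + 1 / ε) ψ := by
  obtain ⟨ω, hω, hr⟩ := exists_phase hτ₀ hin
  have hφ : ∀ x, ‖ω x • ψ x‖ = 1 := fun x => by rw [norm_smul, hω, hψ, one_mul]
  have hδ : ‖ω 0 • ψ 0 - ω 1 • ψ 1‖ ^ 2 = 2 * (1 - τ) := by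
    rw [norm_sub_sq (𝕜 := ℂ), hφ, hφ, hr, RCLike.re_to_complex, Complex.ofReal_re]
    ring
  constructor
  · refine csSup_le (Set.Nonempty.image _
      ⟨_, (IsLOCC.announce .dontKnow).isSeparableMeasurement⟩) ?_
    rintro _ ⟨M, hM, rfl⟩
    have h := expectedPayoff_le_of_isSeparableMeasurement hε hφ hM
    rw [expectedPayoff_phase _ _ hω, hδ] at h
    linarith [show (2 * (1 - τ) / 2) ^ 2 = (1 - τ) ^ 2 by ring]
  · obtain ⟨M, hM, h⟩ := exists_isMeasurement_expectedPayoff_eq (1 + 1 / ε) hτ₀ hτ₁ hφ hr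
    rw [expectedPayoff_phase _ _ hω] at h
    exact h ▸ le_csSup (bddAbove_expectedPayoff (by positivity) hψ) ⟨M, hM, rfl⟩

end Suprema

end StateComparison

theorem mainTheorem1 (τ : ℝ) (hτ₀ : 0 < τ) (hτ₁ : τ < 1) :
    0 < StateComparison.gap τ ∧
    ∃ c : ℝ, 0 < c ∧
      ∀ (d : ℕ) (ψ : Fin 2 → EuclideanSpace ℂ (Fin d)),
        (∀ x, ‖ψ x‖ = 1) → ‖inner ℂ (ψ 0) (ψ 1)‖ = τ →
          StateComparison.sepPayoff c ψ ≤
            StateComparison.maxPayoff c ψ - StateComparison.gap τ ∧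
          StateComparison.loccPayoff c ψ ≤
            StateComparison.maxPayoff c ψ - StateComparison.gap τ ∧
          StateComparison.sepPayoff c ψ ≤ (1 - τ) - StateComparison.gap τ ∧
          1 - τ ≤ StateComparison.maxPayoff c ψ := by
  have hpos : 0 < τ * (1 - τ) := mul_pos hτ₀ (sub_pos.2 hτ₁)
  -- The difference `(1 - τ) - (1 - τ)²` is `τ (1 - τ)`; this `ε` spends nine tenths of it on `4 ε`
  -- and leaves exactly `gap τ`.
  have hε : 0 < 9 / 40 * (τ * (1 - τ)) := by positivity
  refine ⟨by unfold StateComparison.gap; positivity, 1 + 1 / (9 / 40 * (τ * (1 - τ))),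
    by positivity, fun d ψ hψ hin => ?_⟩
  obtain ⟨hsep, hmax⟩ := StateComparison.sepPayoff_le_and_le_maxPayoff hτ₀ hτ₁ hε hψ hin
  have hlocc := StateComparison.loccPayoff_le_sepPayoff (ψ := ψ)
    (c := 1 + 1 / (9 / 40 * (τ * (1 - τ)))) (by positivity) hψ
  have hgap : (1 - τ) ^ 2 + 4 * (9 / 40 * (τ * (1 - τ))) = 1 - τ - StateComparison.gap τ := by
    unfold StateComparison.gap
    ring
  rw [hgap] at hsep
  exact ⟨by linarith, by linarith, hsep, hmax⟩
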